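/- Fix an integer $k\ge 3$. The $k$-Dominating Set problem asks, for a graph $G$ on $n$ vertices, whether there is a set $S$ of exactly $k$ vertices such that every vertex of $G$ lies in $S$ or has a neighbour in $S$. All running times are worst-case step counts on a word RAM with words of length $w\ge d\log_2(n+1)$ for some constant $d$ depending on the program, with $n\ge 1$ and graphs given by their adjacency matrix; matrix multiplication means multiplication of $n\times n$ integer matrices with nonnegative entries bounded by a fixed power of $n$. (1) If two $n\times n$ matrices can be multiplied in time $O(n^2)$ (the meaning of the assumption "$\omega=2$" for exact bounds), then there is an algorithm that solves $k$-Dominating Set and that, for every real $1\le\alpha\le 2$, runs in time $O(n^{k-2+\alpha})$ on the graphs with $n$ vertices and $O(n^\alpha)$ edges. (2) Let $\omega$ be the infimum of all real $\tau$ such that two $n\times n$ matrices can be multiplied in time $O(n^{\tau})$. If $\omega=2$, then for every $\varepsilon>0$ there is an algorithm that solves $k$-Dominating Set and that, for every real $1\le\alpha\le 2$, runs in time $O(n^{k-2+\alpha+\varepsilon})$ on the graphs with $n$ vertices and $O(n^\alpha)$ edges. The constants in the $O(\cdot)$ for the running times in (1) and (2) depend only on $k$, the algorithm, $\alpha$ and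 the constant in the bound $O(n^\alpha)$ on the number of edges. -/

import Mathlib

namespace WordRAM

/-! ## A word RAM with unit-cost instructions on words of `w` bits -/

/-- The binary instructions of the word RAM. -/
inductive BinOp where
  | add | sub | mul | div | mod
  | and | or | xor | shl | shr
  | eq | lt

/-- Binary instructions on unsigned `w`-bit words; arithmetic is modulo `2 ^ w`, and the two
comparisons return `1` (true) or `0` (false). -/
def BinOp.eval {w : ℕ} : BinOp → BitVec w → BitVec w → BitVec w
  | .add, x, y => x + y
  | .sub, x, y => x - y
  | .mul, x, y => x * y
  | .div, x, y => x / y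
  | .mod, x, y => x % y
  | .and, x, y => x &&& y
  | .or, x, y => x ||| y
  | .xor, x, y => x ^^^ y
  | .shl, x, y => x <<< y.toNat
  | .shr, x, y => x >>> y.toNat
  | .eq, x, y => if x = y then 1 else 0
  | .lt, x, y => if x.toNat < y.toNat then 1 else 0

/-- Programs over registers and random-access arrays, both named by natural numbers. A program
is a finite syntax tree, so it mentions only a fixed finite number of registers and arrays. -/
inductive Prog where
  /-- do nothing -/
  | skip
  /-- `const r v`: put the constant `v` into register `r` -/
  | const (r v : ℕ)
  /-- `op o r x y`: put `o` applied to the registers `x` and `y` into register `r` -/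
  | op (o : BinOp) (r x y : ℕ)
  /-- `load r a x`: put the cell of array `a` whose address is in register `x` into `r` -/
  | load (r a x : ℕ)
  /-- `store a x y`: write register `y` to the cell of array `a` whose address is in `x` -/
  | store (a x y : ℕ)
  /-- sequential composition -/
  | seq (p q : Prog)
  /-- `branch r p q`: run `p` if register `r` is nonzero, and `q` otherwise -/
  | branch (r : ℕ) (p q : Prog)
  /-- `loop r p`: while register `r` is nonzero, run `p` -/
  | loop (r : ℕ) (p : Prog)

/-- A memory state: every register holds a word, and every array has one word per address,
addresses being words too. -/
@[ext]
structure State (w : ℕ) where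
  reg : ℕ → BitVec w
  mem : ℕ → BitVec w → BitVec w

/-- Overwrite register `r` with `v`. -/
def State.setReg {w : ℕ} (s : State w) (r : ℕ) (v : BitVec w) : State w :=
  { s with reg := Function.update s.reg r v }

/-- Overwrite the cell of array `a` at address `x` with `v`. -/
def State.setMem {w : ℕ} (s : State w) (a : ℕ) (x v : BitVec w) : State w :=
  { s with mem := Function.update s.mem a (Function.update (s.mem a) x v) }

/-- `Runs p s t s'`: started in state `s`, the program `p` halts after exactly `t` steps in
state `s'`. Every instruction and every test of a branch or of a loop costs one step. -/
inductive Runs {w : ℕ} : Prog → State w → ℕ → State w → Prop where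
  | skip (s : State w) : Runs .skip s 1 s
  | const (s : State w) (r v : ℕ) : Runs (.const r v) s 1 (s.setReg r (BitVec.ofNat w v))
  | op (s : State w) (o : BinOp) (r x y : ℕ) :
      Runs (.op o r x y) s 1 (s.setReg r (o.eval (s.reg x) (s.reg y)))
  | load (s : State w) (r a x : ℕ) :
      Runs (.load r a x) s 1 (s.setReg r (s.mem a (s.reg x)))
  | store (s : State w) (a x y : ℕ) :
      Runs (.store a x y) s 1 (s.setMem a (s.reg x) (s.reg y))
  | seq {p q : Prog} {s s₁ s₂ : State w} {t₁ t₂ : ℕ} :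
      Runs p s t₁ s₁ → Runs q s₁ t₂ s₂ → Runs (.seq p q) s (t₁ + t₂) s₂
  | branch_true {r : ℕ} {p q : Prog} {s s' : State w} {t : ℕ} :
      s.reg r ≠ 0 → Runs p s t s' → Runs (.branch r p q) s (t + 1) s'
  | branch_false {r : ℕ} {p q : Prog} {s s' : State w} {t : ℕ} :
      s.reg r = 0 → Runs q s t s' → Runs (.branch r p q) s (t + 1) s'
  | loop_false {r : ℕ} {p : Prog} {s : State w} :
      s.reg r = 0 → Runs (.loop r p) s 1 s
  | loop_true {r : ℕ} {p : Prog} {s s₁ s₂ : State w} {t₁ t₂ : ℕ} :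
      s.reg r ≠ 0 → Runs p s t₁ s₁ → Runs (.loop r p) s₁ t₂ s₂ →
      Runs (.loop r p) s (t₁ + t₂ + 1) s₂

/-- Array `a` holds the `n × n` matrix `M`, row by row. -/
def StoresMatrix {w : ℕ} (s : State w) (a : ℕ) {n : ℕ} (M : Matrix (Fin n) (Fin n) ℕ) : Prop :=
  ∀ i j : Fin n, (s.mem a (BitVec.ofNat w (i.val * n + j.val))).toNat = M i j

/-! ## Matrix multiplication

A program is always run on words of at least logarithmic length: `(n + 1) ^ d ≤ 2 ^ w`, that is,
`w ≥ d * log₂ (n + 1)`, for some constant `d` that belongs to the program. Only the input is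
prescribed; all other registers and cells initially hold arbitrary words. -/

/-- Multiplication of `n × n` integer matrices with entries polynomially bounded in `n` takes
`O(n ^ τ)` steps: for every `e` there is a program for the matrices with entries in
`{0, …, n ^ e}`. Input: `n` in register `0`, the factors in the arrays `0` and `1`. Output: the
product in array `2`. -/
def MatMulInTime (τ : ℝ) : Prop :=
  ∀ e : ℕ, ∃ (p : Prog) (d : ℕ) (C : ℝ), ∀ n : ℕ, 1 ≤ n →
    ∀ A B : Matrix (Fin n) (Fin n) ℕ, (∀ i j, A i j ≤ n ^ e) → (∀ i j, B i j ≤ n ^ e) →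
    ∀ w : ℕ, (n + 1) ^ d ≤ 2 ^ w →
    ∀ s : State w, (s.reg 0).toNat = n → StoresMatrix s 0 A → StoresMatrix s 1 B →
    ∃ (t : ℕ) (s' : State w), Runs p s t s' ∧ (t : ℝ) ≤ C * (n : ℝ) ^ τ ∧
      StoresMatrix s' 2 (A * B)

/-- The exponent `ω` of matrix multiplication. -/
noncomputable def matMulExponent : ℝ := sInf {τ : ℝ | MatMulInTime τ}

/-! ## The `k`-dominating set problem -/

/-- `G` has a dominating set of size `k`: every vertex is in it or has a neighbour in it. -/
def HasDominatingSet {V : Type*} (G : SimpleGraph V) (k : ℕ) : Prop :=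
  ∃ S : Finset V, S.card = k ∧ ∀ v : V, v ∈ S ∨ ∃ u ∈ S, G.Adj u v

open Classical in
/-- With words of `w ≥ d * log₂ (n + 1)` bits, the program `p` decides within `T` steps whether
the graph `G` on `n` vertices has a dominating set of size `k`. Input: `n` in register `0`, the
adjacency matrix of `G` in array `0`. The answer is yes if register `0` is nonzero at the end. -/
def DecidesDominatingSetWithin (p : Prog) (d k : ℕ) {n : ℕ} (G : SimpleGraph (Fin n))
    (T : ℝ) : Prop :=
  ∀ w : ℕ, (n + 1) ^ d ≤ 2 ^ w →
    ∀ s : State w, (s.reg 0).toNat = n → StoresMatrix s 0 (G.adjMatrix ℕ) →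
    ∃ (t : ℕ) (s' : State w), Runs p s t s' ∧ (t : ℝ) ≤ T ∧
      (s'.reg 0 ≠ 0 ↔ HasDominatingSet G k)

end WordRAM

namespace WordRAM

/-! ## A program logic with time bounds -/

/-- The registers that a program may overwrite. -/
def Prog.WritesReg : Prog → ℕ → Prop
  | .skip, _ => False
  | .const r _, x => x = r
  | .op _ r _ _, x => x = r
  | .load r _ _, x => x = r
  | .store _ _ _, _ => False
  | .seq p q, x => p.WritesReg x ∨ q.WritesReg x
  | .branch _ p q, x => p.WritesReg x ∨ q.WritesReg x
  | .loop _ p, x => p.WritesReg x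

/-- The arrays that a program may overwrite. -/
def Prog.WritesMem : Prog → ℕ → Prop
  | .skip, _ => False
  | .const _ _, _ => False
  | .op _ _ _ _, _ => False
  | .load _ _ _, _ => False
  | .store a _ _, x => x = a
  | .seq p q, x => p.WritesMem x ∨ q.WritesMem x
  | .branch _ p q, x => p.WritesMem x ∨ q.WritesMem x
  | .loop _ p, x => p.WritesMem x

theorem Prog.exists_writes_lt (p : Prog) :
    ∃ b, ∀ x, (p.WritesReg x → x < b) ∧ (p.WritesMem x → x < b) := by
  induction p with
  | skip => exact ⟨0, by simp [WritesReg, WritesMem]⟩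
  | const r v => exact ⟨r + 1, by simp [WritesReg, WritesMem]⟩
  | op o r x y => exact ⟨r + 1, by simp [WritesReg, WritesMem]⟩
  | load r a x => exact ⟨r + 1, by simp [WritesReg, WritesMem]⟩
  | store a x y => exact ⟨a + 1, by simp [WritesReg, WritesMem]⟩
  | seq p q hp hq | branch _ p q hp hq =>
    obtain ⟨b, hb⟩ := hp
    obtain ⟨b', hb'⟩ := hq
    refine ⟨max b b', fun x => ⟨?_, ?_⟩⟩
    · rintro (h | h)
      · exact lt_max_of_lt_left ((hb x).1 h)
      · exact lt_max_of_lt_right ((hb' x).1 h)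
    · rintro (h | h)
      · exact lt_max_of_lt_left ((hb x).2 h)
      · exact lt_max_of_lt_right ((hb' x).2 h)
  | loop r p hp => exact hp

variable {w : ℕ}

@[simp] theorem State.setReg_mem (s : State w) (r : ℕ) (v : BitVec w) :
    (s.setReg r v).mem = s.mem := rfl

@[simp] theorem State.setMem_reg (s : State w) (a : ℕ) (x v : BitVec w) :
    (s.setMem a x v).reg = s.reg := rfl

theorem State.setReg_reg (s : State w) (r x : ℕ) (v : BitVec w) :
    (s.setReg r v).reg x = if x = r then v else s.reg x := by
  simp [State.setReg, Function.update_apply]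

theorem State.setMem_mem (s : State w) (a x : ℕ) (y v z : BitVec w) :
    (s.setMem a y v).mem x z = if x = a ∧ z = y then v else s.mem x z := by
  by_cases h : x = a
  · subst h
    simp [State.setMem, Function.update_apply]
  · simp [State.setMem, h]

/-- `s'` differs from `s` only in places that `p` may overwrite. -/
structure Frame (p : Prog) (s s' : State w) : Prop where
  reg : ∀ r, ¬ p.WritesReg r → s'.reg r = s.reg r
  mem : ∀ a, ¬ p.WritesMem a → s'.mem a = s.mem a

theorem Runs.frame {p : Prog} {s s' : State w} {t : ℕ} (h : Runs p s t s') : Frame p s s' := by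
  induction h with
  | skip s => exact ⟨fun _ _ => rfl, fun _ _ => rfl⟩
  | const s r v | op s o r x y | load s r a x =>
    exact ⟨fun x hx => by
      simp only [Prog.WritesReg] at hx; simp [State.setReg_reg, hx], fun _ _ => rfl⟩
  | store s a x y =>
    exact ⟨fun _ _ => rfl, fun x hx => by
      simp only [Prog.WritesMem] at hx; ext1 z; simp [State.setMem_mem, hx]⟩
  | seq _ _ h₁ h₂ =>
    refine ⟨fun r hr => ?_, fun a ha => ?_⟩
    · simp only [Prog.WritesReg, not_or] at hr
      rw [h₂.reg r hr.2, h₁.reg r hr.1]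
    · simp only [Prog.WritesMem, not_or] at ha
      rw [h₂.mem a ha.2, h₁.mem a ha.1]
  | branch_true _ _ h =>
    exact ⟨fun r hr => h.reg r (fun h' => hr (Or.inl h')),
      fun a ha => h.mem a (fun h' => ha (Or.inl h'))⟩
  | branch_false _ _ h =>
    exact ⟨fun r hr => h.reg r (fun h' => hr (Or.inr h')),
      fun a ha => h.mem a (fun h' => ha (Or.inr h'))⟩
  | loop_false _ => exact ⟨fun _ _ => rfl, fun _ _ => rfl⟩
  | loop_true _ _ _ h₁ h₂ =>
    exact ⟨fun r hr => (h₂.reg r hr).trans (h₁.reg r hr),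
      fun a ha => (h₂.mem a ha).trans (h₁.mem a ha)⟩

/-- Started in `s`, the program `p` halts within `T` steps in a state satisfying `Q`. -/
def Halts (p : Prog) (s : State w) (T : ℕ) (Q : State w → Prop) : Prop :=
  ∃ t s', Runs p s t s' ∧ t ≤ T ∧ Q s'

theorem Halts.mono {p : Prog} {s : State w} {T T' : ℕ} {Q Q' : State w → Prop}
    (h : Halts p s T Q) (hT : T ≤ T') (hQ : ∀ s', Frame p s s' → Q s' → Q' s') :
    Halts p s T' Q' := by
  obtain ⟨t, s', hr, ht, hq⟩ := h
  exact ⟨t, s', hr, ht.trans hT, hQ s' hr.frame hq⟩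

theorem Halts.seq {p q : Prog} {s : State w} {T T' : ℕ} {P Q : State w → Prop}
    (h : Halts p s T P) (hq : ∀ s', Frame p s s' → P s' → Halts q s' T' Q) :
    Halts (.seq p q) s (T + T') Q := by
  obtain ⟨t, s', hr, ht, hp⟩ := h
  obtain ⟨t', s'', hr', ht', hq⟩ := hq s' hr.frame hp
  exact ⟨t + t', s'', .seq hr hr', by omega, hq⟩

theorem Halts.branch {r : ℕ} {p q : Prog} {s : State w} {T : ℕ} {Q : State w → Prop}
    (hp : s.reg r ≠ 0 → Halts p s T Q) (hq : s.reg r = 0 → Halts q s T Q) :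
    Halts (.branch r p q) s (T + 1) Q := by
  by_cases h : s.reg r = 0
  · obtain ⟨t, s', hr, ht, hq⟩ := hq h
    exact ⟨t + 1, s', .branch_false h hr, by omega, hq⟩
  · obtain ⟨t, s', hr, ht, hq⟩ := hp h
    exact ⟨t + 1, s', .branch_true h hr, by omega, hq⟩

/-! ### Straight-line programs -/

/-- The elementary instructions. -/
inductive Instr where
  | const (r v : ℕ)
  | op (o : BinOp) (r x y : ℕ)
  | load (r a x : ℕ)
  | store (a x y : ℕ)

/-- The program consisting of one instruction. -/
def Instr.toProg : Instr → Prog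
  | .const r v => .const r v
  | .op o r x y => .op o r x y
  | .load r a x => .load r a x
  | .store a x y => .store a x y

/-- The effect of one instruction. -/
def Instr.exec : Instr → State w → State w
  | .const r v, s => s.setReg r (BitVec.ofNat w v)
  | .op o r x y, s => s.setReg r (o.eval (s.reg x) (s.reg y))
  | .load r a x, s => s.setReg r (s.mem a (s.reg x))
  | .store a x y, s => s.setMem a (s.reg x) (s.reg y)

/-- The straight-line program of a list of instructions. -/
def straight : List Instr → Prog
  | [] => .skip
  | i :: l => .seq i.toProg (straight l)

/-- The effect of a list of instructions. -/
def execList : List Instr → State w → State w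
  | [], s => s
  | i :: l, s => execList l (i.exec s)

theorem halts_straight (l : List Instr) {s : State w} {Q : State w → Prop}
    (h : Q (execList l s)) : Halts (straight l) s (l.length + 1) Q := by
  induction l generalizing s with
  | nil => exact ⟨1, s, .skip s, le_rfl, h⟩
  | cons i l ih =>
    obtain ⟨t, s', hr, ht, hq⟩ := ih h
    refine ⟨1 + t, s', .seq ?_ hr, by simp only [List.length_cons]; omega, hq⟩
    cases i with
    | const r v => exact .const s r v
    | op o r x y => exact .op s o r x y
    | load r a x => exact .load s r a x
    | store a x y => exact .store s a x y

/-! ### Counting loops -/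

/-- Run `body` with register `i` equal to `0, 1, …, m - 1`, where `m` is the value of the
register `m`; the register `c` is used for scratch work. -/
def forLoop (c i m : ℕ) (body : Prog) : Prog :=
  .seq (.const i 0) (.seq (.op .lt c i m) (.loop c (.seq body
    (.seq (.const c 1) (.seq (.op .add i i c) (.op .lt c i m))))))

theorem writesReg_forLoop {c i m : ℕ} {body : Prog} {r : ℕ} :
    (forLoop c i m body).WritesReg r ↔ r = i ∨ r = c ∨ body.WritesReg r := by
  simp only [forLoop, Prog.WritesReg]; tauto

theorem writesMem_forLoop {c i m : ℕ} {body : Prog} {a : ℕ} :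
    (forLoop c i m body).WritesMem a ↔ body.WritesMem a := by
  simp [forLoop, Prog.WritesMem]

theorem eval_lt_ofNat {a b : ℕ} (ha : a < 2 ^ w) (hb : b < 2 ^ w) :
    BinOp.lt.eval (BitVec.ofNat w a) (BitVec.ofNat w b) =
      BitVec.ofNat w (if a < b then 1 else 0) := by
  simp only [BinOp.eval, BitVec.toNat_ofNat, Nat.mod_eq_of_lt ha, Nat.mod_eq_of_lt hb]
  split_ifs <;> rfl

theorem ofNat_inj {a b : ℕ} (ha : a < 2 ^ w) (hb : b < 2 ^ w) :
    BitVec.ofNat w a = BitVec.ofNat w b ↔ a = b := by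
  constructor
  · intro h
    have := congrArg BitVec.toNat h
    simpa [Nat.mod_eq_of_lt ha, Nat.mod_eq_of_lt hb] using this
  · rintro rfl; rfl

theorem halts_forLoop {c i m : ℕ} {body : Prog} {s : State w} {n : ℕ} (I : ℕ → State w → Prop)
    (T : ℕ → ℕ) (hn : n < 2 ^ w) (hm : s.reg m = BitVec.ofNat w n) (hci : c ≠ i) (hcm : c ≠ m)
    (him : i ≠ m) (hbi : ¬ body.WritesReg i) (hbm : ¬ body.WritesReg m)
    (hI : ∀ x s v v', I x s → I x ((s.setReg i v).setReg c v')) (h0 : I 0 s)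
    (hstep : ∀ x < n, ∀ s₁, Frame (forLoop c i m body) s s₁ → s₁.reg i = BitVec.ofNat w x →
      I x s₁ → Halts body s₁ (T x) (I (x + 1))) :
    Halts (forLoop c i m body) s (∑ x ∈ Finset.range n, (T x + 4) + 3) (I n) := by
  have key : ∀ x ≤ n, ∃ t s₁, (∀ t' s₂, Runs (.loop c (.seq body
      (.seq (.const c 1) (.seq (.op .add i i c) (.op .lt c i m))))) s₁ t' s₂ →
        Runs (forLoop c i m body) s (t + t') s₂) ∧
      t ≤ ∑ x ∈ Finset.range x, (T x + 4) + 2 ∧ s₁.reg i = BitVec.ofNat w x ∧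
      s₁.reg c = BitVec.ofNat w (if x < n then 1 else 0) ∧
      Frame (forLoop c i m body) s s₁ ∧ I x s₁ := by
    intro x
    induction x with
    | zero =>
      intro _
      refine ⟨2, _, fun t' s₂ h => ?_, by simp, ?_, ?_, ?_,
        hI 0 s (BitVec.ofNat w 0) (BitVec.ofNat w (if 0 < n then 1 else 0)) h0⟩
      · have h1 : (BitVec.ofNat w (if 0 < n then 1 else 0)) = BinOp.lt.eval
            ((s.setReg i (BitVec.ofNat w 0)).reg i) ((s.setReg i (BitVec.ofNat w 0)).reg m) := by
          simp only [State.setReg_reg, if_true, if_neg him.symm, hm]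
          rw [eval_lt_ofNat (by positivity) hn]
        rw [h1] at h
        have := Runs.seq (Runs.const s i 0) (Runs.seq (Runs.op _ .lt c i m) h)
        rwa [← add_assoc] at this
      · simp [State.setReg_reg, hci.symm]
      · simp [State.setReg_reg]
      · refine ⟨fun r hr => ?_, fun a _ => rfl⟩
        rw [writesReg_forLoop] at hr
        push Not at hr
        simp [State.setReg_reg, hr.1, hr.2.1]
    | succ x ih =>
      intro hx
      obtain ⟨t, s₁, hrun, ht, hi, hc, hf, hIx⟩ := ih (by omega)
      obtain ⟨t₁, s₂, hrun₁, ht₁, hI₂⟩ := hstep x (by omega) s₁ hf hi hIx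
      have hi2 : s₂.reg i = BitVec.ofNat w x := by rw [hrun₁.frame.reg i hbi, hi]
      have hm2 : s₂.reg m = BitVec.ofNat w n := by
        rw [hrun₁.frame.reg m hbm, hf.reg m, hm]
        rw [writesReg_forLoop]; push Not; exact ⟨him.symm, hcm.symm, hbm⟩
      have h1w : 1 < 2 ^ w := by omega
      refine ⟨t + (t₁ + 3 + 1), (s₂.setReg i (BitVec.ofNat w (x + 1))).setReg c
          (BitVec.ofNat w (if x + 1 < n then 1 else 0)), fun t' s₃ h => ?_, ?_, ?_, ?_, ?_,
        hI _ _ _ _ hI₂⟩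
      · have hne : s₁.reg c ≠ 0 := by
          rw [hc, if_pos (by omega)]
          intro h0
          have := (ofNat_inj (b := 0) h1w (by positivity)).1 h0
          omega
        have hend : Runs (.seq (.const c 1) (.seq (.op .add i i c) (.op .lt c i m))) s₂
            (1 + (1 + 1)) ((s₂.setReg i (BitVec.ofNat w (x + 1))).setReg c
          (BitVec.ofNat w (if x + 1 < n then 1 else 0))) := by
          have hs : ((s₂.setReg i (BitVec.ofNat w (x + 1))).setReg c
              (BitVec.ofNat w (if x + 1 < n then 1 else 0))) =
              (((s₂.setReg c (BitVec.ofNat w 1)).setReg i (BinOp.add.eval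
                ((s₂.setReg c (BitVec.ofNat w 1)).reg i)
                ((s₂.setReg c (BitVec.ofNat w 1)).reg c))).setReg c (BinOp.lt.eval
                (((s₂.setReg c (BitVec.ofNat w 1)).setReg i (BinOp.add.eval
                ((s₂.setReg c (BitVec.ofNat w 1)).reg i)
                ((s₂.setReg c (BitVec.ofNat w 1)).reg c))).reg i)
                (((s₂.setReg c (BitVec.ofNat w 1)).setReg i (BinOp.add.eval
                ((s₂.setReg c (BitVec.ofNat w 1)).reg i)
                ((s₂.setReg c (BitVec.ofNat w 1)).reg c))).reg m))) := by
            have e1 : BinOp.add.eval (BitVec.ofNat w x) (BitVec.ofNat w 1) =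
                BitVec.ofNat w (x + 1) := by
              simp [BinOp.eval, BitVec.ofNat_add]
            simp only [State.setReg_reg, if_true, if_neg him.symm, if_neg hcm.symm,
              if_neg hci.symm, hi2, hm2, e1]
            rw [eval_lt_ofNat (by omega) hn]
            ext1
            · funext r
              simp only [State.setReg_reg]
              split_ifs <;> rfl
            · rfl
          rw [hs]
          exact .seq (.const _ _ _) (.seq (.op _ _ _ _ _) (.op _ _ _ _ _))
        have := hrun _ _ (.loop_true hne (.seq hrun₁ hend) h)
        convert this using 1
        ring
      · rw [Finset.sum_range_succ]; omega
      · simp [State.setReg_reg, hci.symm]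
      · simp [State.setReg_reg]
      · refine ⟨fun r hr => ?_, fun a ha => ?_⟩
        · have hr' := hr
          rw [writesReg_forLoop] at hr
          push Not at hr
          simp only [State.setReg_reg, hr.1, hr.2.1, if_false]
          rw [hrun₁.frame.reg r hr.2.2, hf.reg r hr']
        · have ha' := ha
          rw [writesMem_forLoop] at ha
          simp only [State.setReg_mem]
          rw [hrun₁.frame.mem a ha, hf.mem a ha']
  obtain ⟨t, s₁, hrun, ht, hi, hc, hf, hIn⟩ := key n le_rfl
  refine ⟨t + 1, s₁, hrun 1 s₁ (.loop_false ?_), by omega, hIn⟩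
  rw [hc]; simp

/-! ### Arithmetic on words -/

/-- The truth value of a proposition as a number. -/
noncomputable def bit (P : Prop) : ℕ := open Classical in if P then 1 else 0

theorem bit_le_one (P : Prop) : bit P ≤ 1 := by unfold bit; split_ifs <;> simp

theorem bit_true {P : Prop} (h : P) : bit P = 1 := by simp [bit, h]

theorem bit_false {P : Prop} (h : ¬ P) : bit P = 0 := by simp [bit, h]

theorem bit_congr {P Q : Prop} (h : P ↔ Q) : bit P = bit Q := by rw [propext h]

theorem bit_mul (P Q : Prop) : bit P * bit Q = bit (P ∧ Q) := by
  by_cases hP : P <;> by_cases hQ : Q <;> simp [bit, hP, hQ]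

theorem bit_ne_zero {P : Prop} : bit P ≠ 0 ↔ P := by
  by_cases hP : P <;> simp [bit, hP]

theorem bit_eq_zero {P : Prop} : bit P = 0 ↔ ¬ P := by
  by_cases hP : P <;> simp [bit, hP]

theorem eval_add_ofNat (a b : ℕ) :
    BinOp.add.eval (BitVec.ofNat w a) (BitVec.ofNat w b) = BitVec.ofNat w (a + b) := by
  simp [BinOp.eval, BitVec.ofNat_add]

theorem eval_mul_ofNat (a b : ℕ) :
    BinOp.mul.eval (BitVec.ofNat w a) (BitVec.ofNat w b) = BitVec.ofNat w (a * b) := by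
  simp [BinOp.eval, BitVec.ofNat_mul]

theorem eval_sub_ofNat {a b : ℕ} (hba : b ≤ a) :
    BinOp.sub.eval (BitVec.ofNat w a) (BitVec.ofNat w b) = BitVec.ofNat w (a - b) := by
  obtain ⟨c, rfl⟩ := Nat.exists_eq_add_of_le hba
  simp [BinOp.eval, BitVec.ofNat_add]

theorem eval_div_ofNat {a b : ℕ} (ha : a < 2 ^ w) (hb : b < 2 ^ w) :
    BinOp.div.eval (BitVec.ofNat w a) (BitVec.ofNat w b) = BitVec.ofNat w (a / b) := by
  apply BitVec.eq_of_toNat_eq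
  simp [BinOp.eval, Nat.mod_eq_of_lt ha, Nat.mod_eq_of_lt hb,
    Nat.mod_eq_of_lt ((Nat.div_le_self a b).trans_lt ha)]

theorem eval_mod_ofNat {a b : ℕ} (ha : a < 2 ^ w) (hb : b < 2 ^ w) :
    BinOp.mod.eval (BitVec.ofNat w a) (BitVec.ofNat w b) = BitVec.ofNat w (a % b) := by
  apply BitVec.eq_of_toNat_eq
  simp [BinOp.eval, Nat.mod_eq_of_lt ha, Nat.mod_eq_of_lt hb,
    Nat.mod_eq_of_lt ((Nat.mod_le a b).trans_lt ha)]

theorem eval_eq_ofNat {a b : ℕ} (ha : a < 2 ^ w) (hb : b < 2 ^ w) :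
    BinOp.eq.eval (BitVec.ofNat w a) (BitVec.ofNat w b) = BitVec.ofNat w (bit (a = b)) := by
  simp only [BinOp.eval, ofNat_inj ha hb, bit]
  split_ifs <;> rfl

theorem eval_lt_ofNat_bit {a b : ℕ} (ha : a < 2 ^ w) (hb : b < 2 ^ w) :
    BinOp.lt.eval (BitVec.ofNat w a) (BitVec.ofNat w b) = BitVec.ofNat w (bit (a < b)) := by
  rw [eval_lt_ofNat ha hb, bit]
  split_ifs <;> rfl

theorem eval_or_bit (P Q : Prop) :
    BinOp.or.eval (BitVec.ofNat w (bit P)) (BitVec.ofNat w (bit Q)) =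
      BitVec.ofNat w (bit (P ∨ Q)) := by
  by_cases hP : P <;> by_cases hQ : Q <;> simp [bit, hP, hQ, BinOp.eval]

theorem eval_or_self (x : BitVec w) : BinOp.or.eval x x = x := by
  simp [BinOp.eval]

/-! ## The search for dominating tuples -/

/-- Some `j` vertices `x < n` remove all vertices `v < n` from `U`, where `x` removes the
vertices `v` such that `R x v` fails. -/
def Coverable (n : ℕ) (R : ℕ → ℕ → Prop) : ℕ → (ℕ → Prop) → Prop
  | 0, U => ∀ v < n, ¬ U v
  | j + 1, U => ∃ x < n, Coverable n R j (fun v => U v ∧ R x v)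

/-- The working registers contain `n`, `n * n` and `0`, and the array `b` contains the
relation `R`. -/
structure Ctx (n : ℕ) (R : ℕ → ℕ → Prop) (b : ℕ) (s : State w) : Prop where
  reg_n : s.reg b = BitVec.ofNat w n
  reg_sq : s.reg (b + 1) = BitVec.ofNat w (n * n)
  reg_zero : s.reg (b + 2) = BitVec.ofNat w 0
  mem_rel : ∀ a < n * n, s.mem b (BitVec.ofNat w a) = BitVec.ofNat w (bit (R (a / n) (a % n)))

theorem Ctx.of_frame {n : ℕ} {R : ℕ → ℕ → Prop} {b : ℕ} {s s' : State w} {p : Prog}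
    (h : Ctx n R b s) (hf : Frame p s s') (h0 : ¬ p.WritesReg b) (h1 : ¬ p.WritesReg (b + 1))
    (h2 : ¬ p.WritesReg (b + 2)) (h3 : ¬ p.WritesMem b) : Ctx n R b s' :=
  ⟨(hf.reg _ h0).trans h.reg_n, (hf.reg _ h1).trans h.reg_sq, (hf.reg _ h2).trans h.reg_zero,
    by rw [hf.mem _ h3]; exact h.mem_rel⟩

/-- The array `a` contains the characteristic function of `U` on the numbers below `n`. -/
def StoresSet (n : ℕ) (s : State w) (a : ℕ) (U : ℕ → Prop) : Prop :=
  ∀ v < n, s.mem a (BitVec.ofNat w v) = BitVec.ofNat w (bit (U v))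

/-- Write the factors of the matrix product into the arrays `0` and `1`. -/
def prepareProg (b : ℕ) : Prog :=
  forLoop (b + 4) (b + 5) (b + 1) (straight
    [.load (b + 6) b (b + 5), .op .mod (b + 7) (b + 5) b, .load (b + 7) (b + 1) (b + 7),
     .op .mul (b + 7) (b + 7) (b + 6), .store 0 (b + 5) (b + 7), .store 1 (b + 5) (b + 6)])

/-- Set the flag if the array `2` has a zero entry. -/
def scanProg (b : ℕ) : Prog :=
  forLoop (b + 4) (b + 5) (b + 1) (straight
    [.load (b + 6) 2 (b + 5), .op .eq (b + 6) (b + 6) (b + 2),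
     .op .or (b + 3) (b + 3) (b + 6)])

/-- Set the flag if two vertices suffice for the set in the array `b + 1`. -/
def pairProg (b : ℕ) (p : Prog) : Prog :=
  .seq (prepareProg b) (.seq (straight [.op .or 0 b b]) (.seq p (scanProg b)))

/-- Restrict the set in the array `b + 1 + (j + 1)` to the vertices that are not removed by the
vertex in register `b + 10 + j`, and count the remaining vertices. -/
def restrictProg (b j : ℕ) : Prog :=
  .seq (straight [.op .mul (b + 8) (b + 10 + j) b, .const (b + 9) 0])
    (forLoop (b + 4) (b + 5) b (straight
      [.op .add (b + 6) (b + 8) (b + 5), .load (b + 6) b (b + 6),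
       .load (b + 7) (b + 1 + (j + 1)) (b + 5), .op .mul (b + 6) (b + 7) (b + 6),
       .store (b + 1 + j) (b + 5) (b + 6), .op .add (b + 9) (b + 9) (b + 6)]))

/-- Set the flag if `j + 2` vertices suffice for the set in the array `b + 1 + j`. -/
def searchProg (b : ℕ) (p : Prog) : ℕ → Prog
  | 0 => pairProg b p
  | j + 1 => forLoop (b + 4) (b + 10 + j) b (.seq (restrictProg b j) (searchProg b p j))

section

variable {n : ℕ} {R : ℕ → ℕ → Prop} {b : ℕ} {s : State w} {U : ℕ → Prop}

theorem halts_prepareProg (hn : 1 ≤ n) (hw : n * n < 2 ^ w) (hs : Ctx n R b s) (hb : 3 ≤ b)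
    (hU : StoresSet n s (b + 1) U) :
    Halts (prepareProg b) s (n * n * 11 + 3) (fun s' => ∀ a < n * n,
      s'.mem 0 (BitVec.ofNat w a) = BitVec.ofNat w (bit (U (a % n) ∧ R (a / n) (a % n))) ∧
      s'.mem 1 (BitVec.ofNat w a) = BitVec.ofNat w (bit (R (a / n) (a % n)))) := by
  have hnn : n ≤ n * n := Nat.le_mul_of_pos_left n hn
  refine (halts_forLoop (n := n * n) (fun x s' => ∀ a < x,
      s'.mem 0 (BitVec.ofNat w a) = BitVec.ofNat w (bit (U (a % n) ∧ R (a / n) (a % n))) ∧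
      s'.mem 1 (BitVec.ofNat w a) = BitVec.ofNat w (bit (R (a / n) (a % n)))) (fun _ => 7)
      hw hs.reg_sq (by simp) (by simp) (by simp) ?_ ?_ ?_ ?_ ?_).mono (by simp)
      fun _ _ h => h
  · simp [straight, Instr.toProg, Prog.WritesReg]
  · simp [straight, Instr.toProg, Prog.WritesReg]
  · exact fun x s v v' h => h
  · exact fun a ha => absurd ha (by simp)
  · intro x hx s₁ hf hi hI
    apply halts_straight
    have hs₁ := hs.of_frame hf
      (by simp [writesReg_forLoop, straight, Instr.toProg, Prog.WritesReg])
      (by simp [writesReg_forLoop, straight, Instr.toProg, Prog.WritesReg])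
      (by simp [writesReg_forLoop, straight, Instr.toProg, Prog.WritesReg])
      (by simp [writesMem_forLoop, straight, Instr.toProg, Prog.WritesMem]; omega)
    have hU₁ : StoresSet n s₁ (b + 1) U := by
      unfold StoresSet
      rw [hf.mem (b + 1)]
      · exact hU
      · simp [writesMem_forLoop, straight, Instr.toProg, Prog.WritesMem]; omega
    have e : ∀ a < x + 1, (BitVec.ofNat w a = BitVec.ofNat w x ↔ a = x) := fun a ha =>
      ofNat_inj (by omega) (by omega)
    intro a ha
    simp only [execList, Instr.exec, State.setReg_reg, State.setMem_reg, State.setReg_mem,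
      State.setMem_mem, hi, hs₁.reg_n, Nat.add_left_cancel_iff, if_true,
      OfNat.ofNat_ne_zero, Nat.reduceEqDiff, if_false, Nat.left_eq_add,
      e a ha, true_and, zero_ne_one, one_ne_zero, false_and,
      hs₁.mem_rel x hx, eval_mod_ofNat (show x < 2 ^ w by omega) (show n < 2 ^ w by omega),
      hU₁ (x % n) (Nat.mod_lt _ hn), eval_mul_ofNat, bit_mul]
    split_ifs with h
    · subst h; exact ⟨rfl, rfl⟩
    · exact hI a (by omega)

theorem halts_scanProg {f : ℕ → ℕ} {F : Prop} (hn : 1 ≤ n) (hw : n * n < 2 ^ w)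
    (hs : Ctx n R b s) (hF : s.reg (b + 3) = BitVec.ofNat w (bit F))
    (hf : ∀ a < n * n, (s.mem 2 (BitVec.ofNat w a)).toNat = f a) :
    Halts (scanProg b) s (n * n * 8 + 3) (fun s' =>
      s'.reg (b + 3) = BitVec.ofNat w (bit (F ∨ ∃ a < n * n, f a = 0))) := by
  have hnn : n ≤ n * n := Nat.le_mul_of_pos_left n hn
  refine (halts_forLoop (n := n * n) (fun x s' =>
      s'.reg (b + 3) = BitVec.ofNat w (bit (F ∨ ∃ a < x, f a = 0))) (fun _ => 4)
      hw hs.reg_sq (by simp) (by simp) (by simp) ?_ ?_ ?_ ?_ ?_).mono (by simp)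
      fun _ _ h => h
  · simp [straight, Instr.toProg, Prog.WritesReg]
  · simp [straight, Instr.toProg, Prog.WritesReg]
  · intro x s v v' h
    simpa [State.setReg_reg] using h
  · simpa using hF
  · intro x hx s₁ hfr hi hI
    apply halts_straight
    have hz : s₁.reg (b + 2) = BitVec.ofNat w 0 := by
      rw [hfr.reg, hs.reg_zero]
      simp [writesReg_forLoop, straight, Instr.toProg, Prog.WritesReg]
    have hm : s₁.mem 2 (BitVec.ofNat w x) = BitVec.ofNat w (f x) := by
      rw [hfr.mem, ← hf x hx, BitVec.ofNat_toNat, BitVec.setWidth_eq]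
      simp [writesMem_forLoop, straight, Instr.toProg, Prog.WritesMem]
    have hfx : f x < 2 ^ w := by rw [← hf x hx]; exact BitVec.isLt _
    simp only [execList, Instr.exec, State.setReg_reg, hi, hz, hI, hm,
      Nat.add_left_cancel_iff, Nat.reduceEqDiff, if_true, if_false,
      eval_eq_ofNat hfx (Nat.two_pow_pos w), eval_or_bit]
    congr 1
    apply bit_congr
    rw [or_assoc]
    refine or_congr_right ⟨?_, ?_⟩
    · rintro (⟨a, ha, h⟩ | h)
      · exact ⟨a, by omega, h⟩
      · exact ⟨x, by omega, h⟩
    · rintro ⟨a, ha, h⟩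
      rcases Nat.lt_succ_iff_lt_or_eq.1 ha with h' | rfl
      · exact .inl ⟨a, h', h⟩
      · exact .inr h

/-- `p` multiplies `n × n` matrices with entries in `{0, 1}` within `M` steps. -/
def Multiplies (p : Prog) (w n M : ℕ) : Prop :=
  ∀ A B : Matrix (Fin n) (Fin n) ℕ, (∀ i j, A i j ≤ 1) → (∀ i j, B i j ≤ 1) →
    ∀ s : State w, (s.reg 0).toNat = n → StoresMatrix s 0 A → StoresMatrix s 1 B →
      Halts p s M (fun s' => StoresMatrix s' 2 (A * B))

/-- `p` overwrites only registers and arrays below `b`. -/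
def WritesBelow (p : Prog) (b : ℕ) : Prop :=
  ∀ x, (p.WritesReg x → x < b) ∧ (p.WritesMem x → x < b)

theorem flat_lt {n : ℕ} (i j : Fin n) : i.val * n + j.val < n * n := by
  have := i.isLt
  have := j.isLt
  calc i.val * n + j.val < i.val * n + n := by omega
    _ = (i.val + 1) * n := by ring
    _ ≤ n * n := Nat.mul_le_mul_right n (by omega)

theorem flat_div {n : ℕ} (i j : Fin n) : (i.val * n + j.val) / n = i := by
  rw [add_comm, Nat.add_mul_div_right _ _ (by have := i.isLt; omega), Nat.div_eq_of_lt j.isLt]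
  simp

theorem flat_mod {n : ℕ} (i j : Fin n) : (i.val * n + j.val) % n = j := by
  rw [add_comm, Nat.add_mul_mod_self_right, Nat.mod_eq_of_lt j.isLt]

theorem halts_pairProg {p : Prog} {M : ℕ} {F : Prop} (hp : WritesBelow p b)
    (hM : Multiplies p w n M) (hR : ∀ x y, R x y ↔ R y x) (hn : 1 ≤ n) (hw : n * n < 2 ^ w)
    (hs : Ctx n R b s) (hb : 3 ≤ b) (hU : StoresSet n s (b + 1) U)
    (hF : s.reg (b + 3) = BitVec.ofNat w (bit F)) :
    Halts (pairProg b p) s (M + 19 * (n * n) + 8) (fun s' =>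
      s'.reg (b + 3) = BitVec.ofNat w (bit (F ∨ Coverable n R 2 U))) := by
  have hnn : n ≤ n * n := Nat.le_mul_of_pos_left n hn
  have hpr : ∀ i, ¬ p.WritesReg (b + i) := fun i h => by have := (hp _).1 h; omega
  have hpm : ∀ i, ¬ p.WritesMem (b + i) := fun i h => by have := (hp _).2 h; omega
  let A : Matrix (Fin n) (Fin n) ℕ := fun y v => bit (U v ∧ R y v)
  let B : Matrix (Fin n) (Fin n) ℕ := fun v z => bit (R v z)
  have h1 := halts_prepareProg hn hw hs hb hU
  refine (h1.seq (T' := 2 + (M + (n * n * 8 + 3))) fun s₁ hf₁ h₁ => ?_).mono (by omega)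
    fun _ _ h => h
  have hs₁ := hs.of_frame hf₁
    (by simp [prepareProg, writesReg_forLoop, straight, Instr.toProg, Prog.WritesReg])
    (by simp [prepareProg, writesReg_forLoop, straight, Instr.toProg, Prog.WritesReg])
    (by simp [prepareProg, writesReg_forLoop, straight, Instr.toProg, Prog.WritesReg])
    (by simp [prepareProg, writesMem_forLoop, straight, Instr.toProg, Prog.WritesMem]; omega)
  have hF₁ : s₁.reg (b + 3) = BitVec.ofNat w (bit F) := by
    rw [hf₁.reg, hF]
    simp [prepareProg, writesReg_forLoop, straight, Instr.toProg, Prog.WritesReg]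
  refine (halts_straight [.op .or 0 b b] (Q := fun s₂ => s₂ = s₁.setReg 0 (s₁.reg b))
    (by simp [execList, Instr.exec, eval_or_self])).seq fun s₂ hf₂ h₂ => ?_
  have hs₂ : Ctx n R b s₂ := hs₁.of_frame hf₂
    (by simp [straight, Instr.toProg, Prog.WritesReg]; omega)
    (by simp [straight, Instr.toProg, Prog.WritesReg])
    (by simp [straight, Instr.toProg, Prog.WritesReg])
    (by simp [straight, Instr.toProg, Prog.WritesMem])
  have hF₂ : s₂.reg (b + 3) = BitVec.ofNat w (bit F) := by
    rw [h₂, State.setReg_reg, if_neg (by omega), hF₁]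
  have hbit : ∀ P, bit P < 2 ^ w := fun P => by have := bit_le_one P; omega
  refine (hM A B (fun i j => bit_le_one _) (fun i j => bit_le_one _) s₂ ?_ ?_ ?_).seq
    fun s₃ hf₃ h₃ => ?_
  · rw [h₂, State.setReg_reg, if_pos rfl, hs₁.reg_n, BitVec.toNat_ofNat,
      Nat.mod_eq_of_lt (by omega)]
  · intro i j
    rw [h₂, State.setReg_mem, (h₁ _ (flat_lt i j)).1, flat_div, flat_mod, BitVec.toNat_ofNat,
      Nat.mod_eq_of_lt (hbit _)]
  · intro i j
    rw [h₂, State.setReg_mem, (h₁ _ (flat_lt i j)).2, flat_div, flat_mod, BitVec.toNat_ofNat,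
      Nat.mod_eq_of_lt (hbit _)]
  have hs₃ : Ctx n R b s₃ := hs₂.of_frame hf₃ (hpr 0) (hpr 1) (hpr 2) (hpm 0)
  have hF₃ : s₃.reg (b + 3) = BitVec.ofNat w (bit F) := by rw [hf₃.reg _ (hpr 3), hF₂]
  have hsplit : ∀ a < n * n, a / n < n ∧ a % n < n ∧ a / n * n + a % n = a := fun a ha =>
    ⟨Nat.div_lt_of_lt_mul ha, Nat.mod_lt _ hn, Nat.div_add_mod' a n⟩
  refine (halts_scanProg (f := fun a => ∑ v : Fin n,
    bit (U v ∧ R (a / n) v) * bit (R v (a % n))) hn hw hs₃ hF₃ ?_).mono le_rfl fun s₄ _ h₄ => ?_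
  · intro a ha
    obtain ⟨h, h', h''⟩ := hsplit a ha
    have := h₃ ⟨a / n, h⟩ ⟨a % n, h'⟩
    rw [h''] at this
    exact this
  · rw [h₄]
    congr 1
    apply bit_congr
    refine or_congr_right ⟨?_, ?_⟩
    · rintro ⟨a, ha, h⟩
      obtain ⟨h1, h2, -⟩ := hsplit a ha
      refine ⟨a / n, h1, a % n, h2, fun v hv hh => ?_⟩
      have := (Finset.sum_eq_zero_iff.1 h) ⟨v, hv⟩ (Finset.mem_univ _)
      rw [bit_mul, bit_eq_zero] at this
      exact this ⟨hh.1, (hR _ _).1 hh.2⟩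
    · rintro ⟨y, hy, z, hz, h⟩
      refine ⟨y * n + z, flat_lt ⟨y, hy⟩ ⟨z, hz⟩, Finset.sum_eq_zero fun v _ => ?_⟩
      rw [flat_div ⟨y, hy⟩ ⟨z, hz⟩, flat_mod ⟨y, hy⟩ ⟨z, hz⟩, bit_mul, bit_eq_zero]
      exact fun hh => h v v.isLt ⟨hh.1, (hR _ _).1 hh.2⟩

theorem halts_restrictProg {j x : ℕ} (hn : 1 ≤ n) (hw : n * n < 2 ^ w) (hx : x < n)
    (hs : Ctx n R b s) (hU : StoresSet n s (b + 1 + (j + 1)) U)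
    (hxr : s.reg (b + 10 + j) = BitVec.ofNat w x) :
    Halts (restrictProg b j) s (11 * n + 6) (fun s' =>
      StoresSet n s' (b + 1 + j) (fun v => U v ∧ R x v) ∧
      s'.reg (b + 9) = BitVec.ofNat w (∑ v ∈ Finset.range n, bit (U v ∧ R x v))) := by
  have hnn : n ≤ n * n := Nat.le_mul_of_pos_left n hn
  refine ((halts_straight _ (Q := fun s' => s'.reg (b + 8) = BitVec.ofNat w (x * n) ∧
    s'.reg (b + 9) = BitVec.ofNat w 0) ?_).seq (T' := 11 * n + 3) ?_).mono
      (by simp only [List.length_cons, List.length_nil]; omega) fun _ _ h => h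
  · simp only [execList, Instr.exec, State.setReg_reg, hs.reg_n, hxr, eval_mul_ofNat]
    simp
  intro s₀ hf₀ h₀
  have hs₀ := hs.of_frame hf₀
    (by simp [straight, Instr.toProg, Prog.WritesReg])
    (by simp [straight, Instr.toProg, Prog.WritesReg])
    (by simp [straight, Instr.toProg, Prog.WritesReg])
    (by simp [straight, Instr.toProg, Prog.WritesMem])
  have hU₀ : StoresSet n s₀ (b + 1 + (j + 1)) U := by
    unfold StoresSet
    rw [hf₀.mem _ (by simp [straight, Instr.toProg, Prog.WritesMem])]
    exact hU
  refine (halts_forLoop (n := n) (fun y s' =>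
      (∀ v < y, s'.mem (b + 1 + j) (BitVec.ofNat w v) = BitVec.ofNat w (bit (U v ∧ R x v))) ∧
      s'.reg (b + 9) = BitVec.ofNat w (∑ v ∈ Finset.range y, bit (U v ∧ R x v))) (fun _ => 7)
      (by omega) hs₀.reg_n (by simp) (by simp) (by simp) ?_ ?_ ?_ ?_ ?_).mono
      (by simp; omega) fun _ _ h => h
  · simp [straight, Instr.toProg, Prog.WritesReg]
  · simp [straight, Instr.toProg, Prog.WritesReg]
  · intro y s v v' h
    simpa [State.setReg_reg] using h
  · simpa using h₀.2
  · intro y hy s₁ hf hi hI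
    apply halts_straight
    have hs₁ := hs₀.of_frame hf
      (by simp [writesReg_forLoop, straight, Instr.toProg, Prog.WritesReg])
      (by simp [writesReg_forLoop, straight, Instr.toProg, Prog.WritesReg])
      (by simp [writesReg_forLoop, straight, Instr.toProg, Prog.WritesReg])
      (by simp [writesMem_forLoop, straight, Instr.toProg, Prog.WritesMem]; omega)
    have hU₁ : StoresSet n s₁ (b + 1 + (j + 1)) U := by
      unfold StoresSet
      rw [hf.mem _ (by simp [writesMem_forLoop, straight, Instr.toProg, Prog.WritesMem])]
      exact hU₀
    have h8 : s₁.reg (b + 8) = BitVec.ofNat w (x * n) := by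
      rw [hf.reg, h₀.1]
      simp [writesReg_forLoop, straight, Instr.toProg, Prog.WritesReg]
    have e : ∀ a < y + 1, (BitVec.ofNat w a = BitVec.ofNat w y ↔ a = y) := fun a ha =>
      ofNat_inj (by omega) (by omega)
    have hr := hs₁.mem_rel _ (flat_lt ⟨x, hx⟩ ⟨y, hy⟩)
    rw [flat_div, flat_mod] at hr
    refine ⟨fun a ha => ?_, ?_⟩
    · simp only [execList, Instr.exec, State.setReg_reg, State.setMem_reg, State.setReg_mem,
        State.setMem_mem, hi, h8, Nat.add_left_cancel_iff, if_true,
        Nat.reduceEqDiff, if_false, e a ha, true_and, eval_add_ofNat, hr,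
        hU₁ y hy, eval_mul_ofNat, bit_mul]
      split_ifs with h
      · subst h; rfl
      · exact hI.1 a (by omega)
    · simp only [execList, Instr.exec, State.setReg_reg, State.setMem_reg, State.setReg_mem,
        hi, h8, Nat.add_left_cancel_iff, if_true,
        Nat.reduceEqDiff, if_false, eval_add_ofNat, hr,
        hU₁ y hy, eval_mul_ofNat, bit_mul, hI.2, Finset.sum_range_succ]

theorem WritesBelow.pairProg {p : Prog} (hp : WritesBelow p b) (hb : 3 ≤ b) {r : ℕ} :
    ((pairProg b p).WritesReg r → r < b ∨ b + 3 ≤ r ∧ r < b + 10) ∧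
    ((WordRAM.pairProg b p).WritesMem r → r < b) := by
  have := hp r
  simp only [WordRAM.pairProg, prepareProg, scanProg, writesReg_forLoop, writesMem_forLoop,
    straight, Instr.toProg, Prog.WritesReg, Prog.WritesMem]
  grind (splits := 40)

theorem restrictProg_writes {j r : ℕ} :
    ((restrictProg b j).WritesReg r → b + 3 ≤ r ∧ r < b + 10) ∧
    ((restrictProg b j).WritesMem r → r = b + 1 + j) := by
  simp only [restrictProg, writesReg_forLoop, writesMem_forLoop,
    straight, Instr.toProg, Prog.WritesReg, Prog.WritesMem]
  grind (splits := 40)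

theorem WritesBelow.searchProg {p : Prog} (hp : WritesBelow p b) (hb : 3 ≤ b) (j : ℕ) {r : ℕ} :
    ((searchProg b p j).WritesReg r → r < b ∨ b + 3 ≤ r ∧ r < b + 10 + j) ∧
    ((WordRAM.searchProg b p j).WritesMem r → r < b ∨ b + 1 ≤ r ∧ r < b + 1 + j) := by
  induction j with
  | zero =>
    have := hp.pairProg hb (r := r)
    exact ⟨this.1, fun h => .inl (this.2 h)⟩
  | succ j ih =>
    have := restrictProg_writes (b := b) (j := j) (r := r)
    simp only [WordRAM.searchProg, writesReg_forLoop, writesMem_forLoop, Prog.WritesReg,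
      Prog.WritesMem]
    grind

/-- A bound for the running time of `searchProg`. -/
def searchTime (M n : ℕ) : ℕ → ℕ
  | 0 => M + 19 * (n * n) + 8
  | j + 1 => n * (11 * n + 6 + searchTime M n j + 4) + 3

theorem halts_searchProg {p : Prog} {M : ℕ} {F : Prop} (hp : WritesBelow p b)
    (hM : Multiplies p w n M) (hR : ∀ x y, R x y ↔ R y x) (hn : 1 ≤ n) (hw : n * n < 2 ^ w)
    (hb : 3 ≤ b) (j : ℕ) (hs : Ctx n R b s) (hU : StoresSet n s (b + 1 + j) U)
    (hF : s.reg (b + 3) = BitVec.ofNat w (bit F)) :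
    Halts (searchProg b p j) s (searchTime M n j) (fun s' =>
      s'.reg (b + 3) = BitVec.ofNat w (bit (F ∨ Coverable n R (j + 2) U))) := by
  induction j generalizing s U F with
  | zero => exact halts_pairProg hp hM hR hn hw hs hb hU hF
  | succ j ih =>
    have hnn : n ≤ n * n := Nat.le_mul_of_pos_left n hn
    have hwr := fun r => hp.searchProg hb j (r := r)
    have hwr' := fun r => restrictProg_writes (b := b) (j := j) (r := r)
    refine (halts_forLoop (n := n) (fun x s' => s'.reg (b + 3) = BitVec.ofNat w (bit
      (F ∨ ∃ y < x, Coverable n R (j + 2) (fun v => U v ∧ R y v))))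
      (fun _ => 11 * n + 6 + searchTime M n j)
      (by omega) hs.reg_n (by omega) (by omega) (by omega) ?_ ?_ ?_ ?_ ?_).mono
      (by simp [searchTime]) fun _ _ h => h
    · simp only [Prog.WritesReg]
      grind
    · simp only [Prog.WritesReg]
      grind
    · intro x s v v' h
      rw [State.setReg_reg, if_neg (by omega), State.setReg_reg, if_neg (by omega), h]
    · simpa using hF
    · intro x hx s₁ hf hi hI
      have hs₁ : Ctx n R b s₁ := hs.of_frame hf
        (by simp only [writesReg_forLoop, Prog.WritesReg]; grind)
        (by simp only [writesReg_forLoop, Prog.WritesReg]; grind)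
        (by simp only [writesReg_forLoop, Prog.WritesReg]; grind)
        (by simp only [writesMem_forLoop, Prog.WritesMem]; grind)
      have hU₁ : StoresSet n s₁ (b + 1 + (j + 1)) U := by
        unfold StoresSet
        rw [hf.mem _ (by simp only [writesMem_forLoop, Prog.WritesMem]; grind)]
        exact hU
      have hr := halts_restrictProg hn hw hx hs₁ hU₁ hi
      refine hr.seq fun s₂ hf₂ h₂ => ?_
      have hs₂ : Ctx n R b s₂ := hs₁.of_frame hf₂ (by grind) (by grind) (by grind) (by grind)
      have hF₂ : s₂.reg (b + 3) = BitVec.ofNat w (bit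
          (F ∨ ∃ y < x, Coverable n R (j + 2) (fun v => U v ∧ R y v))) := by
        rw [hf₂.reg, hI]
        simp [restrictProg, writesReg_forLoop, straight, Instr.toProg, Prog.WritesReg]
      refine (ih hs₂ h₂.1 hF₂).mono le_rfl fun s₃ _ h₃ => ?_
      rw [h₃]
      congr 1
      apply bit_congr
      rw [or_assoc]
      refine or_congr_right ⟨?_, ?_⟩
      · rintro (⟨a, ha, h⟩ | h)
        · exact ⟨a, by omega, h⟩
        · exact ⟨x, by omega, h⟩
      · rintro ⟨a, ha, h⟩
        rcases Nat.lt_succ_iff_lt_or_eq.1 ha with h' | rfl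
        · exact .inl ⟨a, h', h⟩
        · exact .inr h

/-- Initialize the working registers, write the relation "neither adjacent nor equal" into the
array `b` and the full set into the array `t`. -/
def setupProg (b t : ℕ) : Prog :=
  .seq (straight [.op .or b 0 0, .const (b + 2) 0, .const (b + 3) 0, .op .mul (b + 1) b b])
    (forLoop (b + 4) (b + 5) (b + 1) (straight
      [.load (b + 6) 0 (b + 5), .op .div (b + 7) (b + 5) b, .op .mod (b + 8) (b + 5) b,
       .op .eq (b + 7) (b + 7) (b + 8), .op .or (b + 6) (b + 6) (b + 7),
       .op .eq (b + 6) (b + 6) (b + 2), .store b (b + 5) (b + 6), .const (b + 6) 1,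
       .store t (b + 5) (b + 6)]))

/-- The program for dominating sets of size `k = j + 3`, which tries only vertices of degree at
least `n / k - 1` as the first vertex. -/
def domProg (b : ℕ) (p : Prog) (k j : ℕ) : Prog :=
  .seq (setupProg b (b + 1 + (j + 1)))
    (.seq (forLoop (b + 4) (b + 10 + j) b (.seq (restrictProg b j)
      (.seq (straight [.const (b + 6) k, .op .sub (b + 7) b (b + 9),
        .op .mul (b + 6) (b + 6) (b + 7), .op .lt (b + 6) (b + 6) b])
        (.branch (b + 6) .skip (searchProg b p j)))))
    (straight [.const (b + 6) k, .op .lt (b + 6) b (b + 6), .op .eq (b + 6) (b + 6) (b + 2),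
      .op .mul 0 (b + 3) (b + 6)]))

theorem halts_setupProg {E : ℕ → ℕ → Prop} {t : ℕ} (hn : 1 ≤ n) (hw : n * n < 2 ^ w)
    (hb : 3 ≤ b) (ht : b < t) (hreg : s.reg 0 = BitVec.ofNat w n)
    (hE : ∀ a < n * n, s.mem 0 (BitVec.ofNat w a) = BitVec.ofNat w (bit (E (a / n) (a % n)))) :
    Halts (setupProg b t) s (n * n * 14 + 8) (fun s' =>
      Ctx n (fun x v => ¬ (E x v ∨ x = v)) b s' ∧ s'.reg (b + 3) = BitVec.ofNat w (bit False) ∧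
      StoresSet n s' t (fun _ => True)) := by
  have hnn : n ≤ n * n := Nat.le_mul_of_pos_left n hn
  refine ((halts_straight _ (Q := fun s' => s'.reg b = BitVec.ofNat w n ∧
    s'.reg (b + 1) = BitVec.ofNat w (n * n) ∧ s'.reg (b + 2) = BitVec.ofNat w 0 ∧
    s'.reg (b + 3) = BitVec.ofNat w (bit False)) ?_).seq (T' := n * n * 14 + 3) ?_).mono
      (by simp only [List.length_cons, List.length_nil]; omega) fun _ _ h => h
  · simp [execList, Instr.exec, State.setReg_reg, hreg, eval_or_self, eval_mul_ofNat, bit_false]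
  rintro s₀ hf₀ ⟨h0, h1, h2, h3⟩
  have hE₀ : ∀ a < n * n,
      s₀.mem 0 (BitVec.ofNat w a) = BitVec.ofNat w (bit (E (a / n) (a % n))) := by
    rw [hf₀.mem _ (by simp [straight, Instr.toProg, Prog.WritesMem])]
    exact hE
  refine (halts_forLoop (n := n * n) (fun y s' =>
      (∀ a < y, s'.mem b (BitVec.ofNat w a) =
        BitVec.ofNat w (bit (¬ (E (a / n) (a % n) ∨ a / n = a % n)))) ∧
      (∀ a < y, s'.mem t (BitVec.ofNat w a) = BitVec.ofNat w 1)) (fun _ => 10)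
      hw h1 (by simp) (by simp) (by simp) ?_ ?_ ?_ ?_ ?_).mono
      (by simp) ?_
  · simp [straight, Instr.toProg, Prog.WritesReg]
  · simp [straight, Instr.toProg, Prog.WritesReg]
  · exact fun y s v v' h => h
  · simp
  · intro y hy s₁ hf hi hI
    apply halts_straight
    have hN : s₁.reg b = BitVec.ofNat w n := by
      rw [hf.reg, h0]
      simp [writesReg_forLoop, straight, Instr.toProg, Prog.WritesReg]
    have hz : s₁.reg (b + 2) = BitVec.ofNat w 0 := by
      rw [hf.reg, h2]
      simp [writesReg_forLoop, straight, Instr.toProg, Prog.WritesReg]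
    have hE₁ : ∀ a < n * n,
        s₁.mem 0 (BitVec.ofNat w a) = BitVec.ofNat w (bit (E (a / n) (a % n))) := by
      rw [hf.mem _ (by simp [writesMem_forLoop, straight, Instr.toProg, Prog.WritesMem]; omega)]
      exact hE₀
    have e : ∀ a < y + 1, (BitVec.ofNat w a = BitVec.ofNat w y ↔ a = y) := fun a ha =>
      ofNat_inj (by omega) (by omega)
    have hbit : ∀ P, bit P < 2 ^ w := fun P => by have := bit_le_one P; omega
    have hd : y / n < 2 ^ w := (Nat.div_le_self y n).trans_lt (by omega)
    have hm : y % n < 2 ^ w := (Nat.mod_le y n).trans_lt (by omega)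
    have htb : t ≠ b := by omega
    refine ⟨fun a ha => ?_, fun a ha => ?_⟩
    · simp only [execList, Instr.exec, State.setReg_reg, State.setMem_reg, State.setReg_mem,
        State.setMem_mem, hi, hN, hz, Nat.add_left_cancel_iff, if_true, Nat.left_eq_add,
        OfNat.ofNat_ne_zero, htb.symm, false_and,
        Nat.reduceEqDiff, if_false, e a ha, true_and, hE₁ y hy, eval_or_bit,
        eval_div_ofNat (show y < 2 ^ w by omega) (show n < 2 ^ w by omega),
        eval_mod_ofNat (show y < 2 ^ w by omega) (show n < 2 ^ w by omega),
        eval_eq_ofNat hd hm, eval_eq_ofNat (hbit _) (Nat.two_pow_pos w), bit_eq_zero]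
      split_ifs with h
      · subst h; rfl
      · exact hI.1 a (by omega)
    · simp only [execList, Instr.exec, State.setReg_reg, State.setMem_reg, State.setReg_mem,
        State.setMem_mem, hi, Nat.add_left_cancel_iff, if_true,
        htb, false_and, Nat.reduceEqDiff, if_false, e a ha, true_and]
      split_ifs with h
      · rfl
      · exact hI.2 a (by omega)
  · rintro s₁ hf ⟨hI, hI'⟩
    refine ⟨⟨?_, ?_, ?_, hI⟩, ?_, ?_⟩
    · rw [hf.reg, h0]
      simp [writesReg_forLoop, straight, Instr.toProg, Prog.WritesReg]
    · rw [hf.reg, h1]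
      simp [writesReg_forLoop, straight, Instr.toProg, Prog.WritesReg]
    · rw [hf.reg, h2]
      simp [writesReg_forLoop, straight, Instr.toProg, Prog.WritesReg]
    · rw [hf.reg, h3]
      simp [writesReg_forLoop, straight, Instr.toProg, Prog.WritesReg]
    · intro v hv
      rw [hI' v (by omega), bit_true trivial]

/-- At least `n / k` of the vertices below `n` are equal or adjacent to `x`. -/
def Heavy (n k : ℕ) (E : ℕ → ℕ → Prop) (x : ℕ) : Prop :=
  n ≤ k * (n - ∑ v ∈ Finset.range n, bit (¬ (E x v ∨ x = v)))

theorem halts_domProg {p : Prog} {M k j : ℕ} {E : ℕ → ℕ → Prop} (hp : WritesBelow p b)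
    (hM : Multiplies p w n M) (hE : ∀ x y, E x y ↔ E y x) (hn : 1 ≤ n) (hw : n * n < 2 ^ w)
    (hk : k * n < 2 ^ w) (hb : 3 ≤ b) (hreg : s.reg 0 = BitVec.ofNat w n)
    (hmem : ∀ a < n * n, s.mem 0 (BitVec.ofNat w a) = BitVec.ofNat w (bit (E (a / n) (a % n)))) :
    Halts (domProg b p k j) s
      (n * n * 14 + 8 + (∑ x ∈ Finset.range n,
        (11 * n + 13 + bit (Heavy n k E x) * searchTime M n j + 4) + 3 + 5))
      (fun s' => s'.reg 0 = BitVec.ofNat w (bit ((∃ x < n, Heavy n k E x ∧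
        Coverable n (fun x v => ¬ (E x v ∨ x = v)) (j + 2) (fun v => ¬ (E x v ∨ x = v))) ∧
        k ≤ n))) := by
  have hnn : n ≤ n * n := Nat.le_mul_of_pos_left n hn
  have hkw : k < 2 ^ w := (Nat.le_mul_of_pos_right k hn).trans_lt hk
  have hbit : ∀ P, bit P < 2 ^ w := fun P => by have := bit_le_one P; omega
  have hwr := fun r => hp.searchProg hb j (r := r)
  have hwr' := fun r => restrictProg_writes (b := b) (j := j) (r := r)
  have hR : ∀ x y, ¬ (E x y ∨ x = y) ↔ ¬ (E y x ∨ y = x) := fun x y => by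
    rw [hE x y, eq_comm]
  generalize hRdef : (fun x v => ¬ (E x v ∨ x = v)) = R
  have hR' : ∀ x v, (¬ (E x v ∨ x = v)) = R x v := fun x v => by rw [← hRdef]
  refine (halts_setupProg (t := b + 1 + (j + 1)) hn hw hb (by omega) hreg hmem).seq ?_
  rw [hRdef]
  rintro s₀ hf₀ ⟨hs₀, hF₀, hU₀⟩
  refine (halts_forLoop (n := n) (fun x s' => s'.reg (b + 3) = BitVec.ofNat w (bit
      (∃ y < x, Heavy n k E y ∧ Coverable n R (j + 2) (R y))))
      (fun x => 11 * n + 13 + bit (Heavy n k E x) * searchTime M n j)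
      (by omega) hs₀.reg_n (by omega) (by omega) (by omega) ?_ ?_ ?_ ?_ ?_).seq ?_
  · simp only [Prog.WritesReg, straight, Instr.toProg]
    grind
  · simp only [Prog.WritesReg, straight, Instr.toProg]
    grind
  · intro x s v v' h
    rw [State.setReg_reg, if_neg (by omega), State.setReg_reg, if_neg (by omega), h]
  · simpa using hF₀
  · intro x hx s₁ hf hi hI
    have hs₁ : Ctx n R b s₁ := hs₀.of_frame hf
      (by simp only [writesReg_forLoop, Prog.WritesReg, straight, Instr.toProg]; grind)
      (by simp only [writesReg_forLoop, Prog.WritesReg, straight, Instr.toProg]; grind)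
      (by simp only [writesReg_forLoop, Prog.WritesReg, straight, Instr.toProg]; grind)
      (by simp only [writesMem_forLoop, Prog.WritesMem, straight, Instr.toProg]; grind)
    have hU₁ : StoresSet n s₁ (b + 1 + (j + 1)) (fun _ => True) := by
      unfold StoresSet
      rw [hf.mem _ (by simp only [writesMem_forLoop, Prog.WritesMem, straight, Instr.toProg]
                       grind)]
      exact hU₀
    refine ((halts_restrictProg hn hw hx hs₁ hU₁ hi).seq
      (T' := 7 + bit (Heavy n k E x) * searchTime M n j) fun s₂ hf₂ h₂ => ?_).mono
      (by omega) fun _ _ h => h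
    simp only [true_and] at h₂
    obtain ⟨hU₂, hc₂⟩ := h₂
    have hs₂ : Ctx n R b s₂ := hs₁.of_frame hf₂ (by grind) (by grind) (by grind) (by grind)
    have hF₂ := hf₂.reg (b + 3)
      (by simp [restrictProg, writesReg_forLoop, straight, Instr.toProg, Prog.WritesReg])
    rw [hI] at hF₂
    have hcnt : ∑ v ∈ Finset.range n, bit (R x v) ≤ n := by
      simpa using Finset.sum_le_card_nsmul (Finset.range n) _ 1 (fun v _ => bit_le_one (R x v))
    have hH : Heavy n k E x ↔ n ≤ k * (n - ∑ v ∈ Finset.range n, bit (R x v)) := by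
      simp only [Heavy, hR']
    refine ((halts_straight _ (Q := fun s₃ => s₃.reg (b + 6) =
      BitVec.ofNat w (bit (¬ Heavy n k E x))) ?_).seq
      (T' := 1 + bit (Heavy n k E x) * searchTime M n j + 1) fun s₃ hf₃ h₃ => ?_).mono
      (by simp only [List.length_cons, List.length_nil]; omega) fun _ _ h => h
    · simp only [execList, Instr.exec, State.setReg_reg, Nat.add_left_cancel_iff, if_true,
        Nat.reduceEqDiff, if_false, Nat.left_eq_add, OfNat.ofNat_ne_zero, hs₂.reg_n, hc₂,
        eval_sub_ofNat hcnt, eval_mul_ofNat]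
      rw [eval_lt_ofNat_bit ((Nat.mul_le_mul_left k (Nat.sub_le _ _)).trans_lt hk) (by omega)]
      rw [hH, not_le]
    have hs₃ : Ctx n R b s₃ := hs₂.of_frame hf₃
      (by simp [straight, Instr.toProg, Prog.WritesReg])
      (by simp [straight, Instr.toProg, Prog.WritesReg])
      (by simp [straight, Instr.toProg, Prog.WritesReg])
      (by simp [straight, Instr.toProg, Prog.WritesMem])
    have hU₃ : StoresSet n s₃ (b + 1 + j) (R x) := by
      unfold StoresSet
      rw [hf₃.mem _ (by simp [straight, Instr.toProg, Prog.WritesMem])]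
      exact hU₂
    have hF₃ := hf₃.reg (b + 3) (by simp [straight, Instr.toProg, Prog.WritesReg])
    rw [hF₂] at hF₃
    have hex : (∃ y < x + 1, Heavy n k E y ∧ Coverable n R (j + 2) (R y)) ↔
        (∃ y < x, Heavy n k E y ∧ Coverable n R (j + 2) (R y)) ∨
          (Heavy n k E x ∧ Coverable n R (j + 2) (R x)) := by
      constructor
      · rintro ⟨a, ha, h⟩
        rcases Nat.lt_succ_iff_lt_or_eq.1 ha with h' | rfl
        · exact .inl ⟨a, h', h⟩
        · exact .inr h
      · rintro (⟨a, ha, h⟩ | h)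
        · exact ⟨a, by omega, h⟩
        · exact ⟨x, by omega, h⟩
    refine Halts.branch (fun h => ?_) (fun h => ?_)
    · have hnH : ¬ Heavy n k E x := by
        intro hH
        rw [h₃, bit_false (not_not.2 hH)] at h
        exact h rfl
      refine ⟨1, s₃, .skip s₃, by omega, ?_⟩
      change s₃.reg (b + 3) = _
      rw [hF₃]
      congr 1
      apply bit_congr
      rw [hex]
      simp only [hnH, false_and, or_false]
    · have hHx : Heavy n k E x := by
        by_contra hH
        rw [h₃, bit_true hH] at h
        have := (ofNat_inj (b := 0) (by omega) (Nat.two_pow_pos w)).1 h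
        omega
      refine (halts_searchProg hp hM (by rw [← hRdef]; exact hR) hn hw hb j hs₃ hU₃ hF₃).mono
        (by rw [bit_true hHx]; omega) fun s₄ _ h₄ => ?_
      rw [h₄]
      congr 1
      apply bit_congr
      rw [hex]
      simp only [hHx, true_and]
  · intro s₁ hf hI
    apply halts_straight
    have hs₁ : Ctx n R b s₁ := hs₀.of_frame hf
      (by simp only [writesReg_forLoop, Prog.WritesReg, straight, Instr.toProg]; grind)
      (by simp only [writesReg_forLoop, Prog.WritesReg, straight, Instr.toProg]; grind)
      (by simp only [writesReg_forLoop, Prog.WritesReg, straight, Instr.toProg]; grind)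
      (by simp only [writesMem_forLoop, Prog.WritesMem, straight, Instr.toProg]; grind)
    simp only [execList, Instr.exec, State.setReg_reg, Nat.add_left_cancel_iff, if_true,
      Nat.reduceEqDiff, if_false, Nat.left_eq_add, OfNat.ofNat_ne_zero, hs₁.reg_n,
      hs₁.reg_zero, hI, eval_lt_ofNat_bit (show n < 2 ^ w by omega) hkw,
      eval_eq_ofNat (hbit _) (Nat.two_pow_pos w), eval_mul_ofNat, bit_mul, bit_eq_zero, not_lt,
      hR']

end

/-! ## Graphs -/

theorem coverable_iff {n : ℕ} (hn : 1 ≤ n) {R : ℕ → ℕ → Prop} {j : ℕ} {U : ℕ → Prop} :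
    Coverable n R j U ↔
      ∃ S : Finset (Fin n), S.card ≤ j ∧ ∀ v : Fin n, U v → ∃ x ∈ S, ¬ R x v := by
  induction j generalizing U with
  | zero =>
    constructor
    · exact fun h => ⟨∅, by simp, fun v hv => absurd hv (h v v.isLt)⟩
    · rintro ⟨S, hS, h⟩ v hv hU
      obtain ⟨x, hx, -⟩ := h ⟨v, hv⟩ hU
      simp [Finset.card_eq_zero.1 (Nat.le_zero.1 hS)] at hx
  | succ j ih =>
    simp only [Coverable, ih]
    constructor
    · rintro ⟨x, hx, S, hS, h⟩
      refine ⟨insert ⟨x, hx⟩ S, (Finset.card_insert_le _ _).trans (by omega), fun v hv => ?_⟩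
      by_cases hR : R x v
      · obtain ⟨y, hy, hyv⟩ := h v ⟨hv, hR⟩
        exact ⟨y, Finset.mem_insert_of_mem hy, hyv⟩
      · exact ⟨⟨x, hx⟩, Finset.mem_insert_self _ _, hR⟩
    · rintro ⟨S, hS, h⟩
      rcases S.eq_empty_or_nonempty with rfl | ⟨x, hx⟩
      · exact ⟨0, hn, ∅, by simp, fun v hv => h v hv.1⟩
      · refine ⟨x, x.isLt, S.erase x, by rw [Finset.card_erase_of_mem hx]; omega, ?_⟩
        rintro v ⟨hv, hxv⟩
        obtain ⟨y, hy, hyv⟩ := h v hv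
        exact ⟨y, Finset.mem_erase.2 ⟨by rintro rfl; exact hyv hxv, hy⟩, hyv⟩

/-- Adjacency of vertices given by their numbers. -/
def AdjNat {n : ℕ} (G : SimpleGraph (Fin n)) (x y : ℕ) : Prop :=
  ∃ (hx : x < n) (hy : y < n), G.Adj ⟨x, hx⟩ ⟨y, hy⟩

section

variable {n : ℕ} {G : SimpleGraph (Fin n)}

theorem adjNat_coe (x y : Fin n) : AdjNat G x y ↔ G.Adj x y :=
  ⟨fun ⟨_, _, h⟩ => h, fun h => ⟨x.isLt, y.isLt, h⟩⟩

theorem adjNat_comm (x y : ℕ) : AdjNat G x y ↔ AdjNat G y x :=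
  ⟨fun ⟨hx, hy, h⟩ => ⟨hy, hx, h.symm⟩, fun ⟨hx, hy, h⟩ => ⟨hy, hx, h.symm⟩⟩

open Classical in
theorem heavy_iff {k : ℕ} {x : Fin n} :
    Heavy n k (AdjNat G) x ↔
      n ≤ k * (Finset.univ.filter fun v : Fin n => G.Adj x v ∨ x = v).card := by
  have h := Finset.card_filter_add_card_filter_not (s := (Finset.univ : Finset (Fin n)))
    (fun v => G.Adj x v ∨ x = v)
  rw [Finset.card_univ, Fintype.card_fin] at h
  have h' : ∑ v ∈ Finset.range n, bit (¬ (AdjNat G x v ∨ (x : ℕ) = v)) =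
      (Finset.univ.filter fun v : Fin n => ¬ (G.Adj x v ∨ x = v)).card := by
    rw [Finset.sum_range, Finset.card_filter]
    refine Finset.sum_congr rfl fun v _ => ?_
    simp only [adjNat_coe, Fin.val_inj, bit]
  rw [Heavy, h']
  congr! 2
  omega

theorem hasDominatingSet_iff (hn : 1 ≤ n) (j : ℕ) :
    HasDominatingSet G (j + 3) ↔ (∃ x < n, Heavy n (j + 3) (AdjNat G) x ∧
      Coverable n (fun x v => ¬ (AdjNat G x v ∨ x = v)) (j + 2)
        (fun v => ¬ (AdjNat G x v ∨ x = v))) ∧ j + 3 ≤ n := by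
  classical
  simp only [coverable_iff hn, not_not]
  constructor
  · rintro ⟨S, hS, h⟩
    refine ⟨?_, by rw [← hS]; simpa using S.card_le_univ⟩
    have hne : S.Nonempty := Finset.card_pos.1 (by omega)
    obtain ⟨x, hx, hxn⟩ := Finset.exists_le_of_sum_le (f := fun _ => n) (g := fun x =>
      (j + 3) * (Finset.univ.filter fun v : Fin n => G.Adj x v ∨ x = v).card) hne (by
        rw [Finset.sum_const, hS, ← Finset.mul_sum, smul_eq_mul]
        refine Nat.mul_le_mul_left _ ?_
        refine le_trans ?_ Finset.card_biUnion_le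
        rw [Finset.eq_univ_of_forall (s := S.biUnion _), Finset.card_univ, Fintype.card_fin]
        intro v
        rw [Finset.mem_biUnion]
        rcases h v with hv | ⟨u, hu, huv⟩
        · exact ⟨v, hv, by simp⟩
        · exact ⟨u, hu, by simp [huv]⟩)
    refine ⟨x, x.isLt, heavy_iff.2 hxn, S.erase x,
      by rw [Finset.card_erase_of_mem hx]; omega, fun v hv => ?_⟩
    obtain ⟨u, hu, huv⟩ : ∃ u ∈ S, G.Adj u v ∨ u = v := by
      rcases h v with hv | ⟨u, hu, huv⟩
      · exact ⟨v, hv, .inr rfl⟩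
      · exact ⟨u, hu, .inl huv⟩
    have huv' : AdjNat G u v ∨ (u : ℕ) = v := by rwa [adjNat_coe, Fin.val_inj]
    exact ⟨u, Finset.mem_erase.2 ⟨by rintro rfl; exact hv huv', hu⟩, huv'⟩
  · rintro ⟨⟨x, hx, -, S, hS, h⟩, hk⟩
    obtain ⟨S', hS', hc⟩ := Finset.exists_superset_card_eq (s := insert ⟨x, hx⟩ S) (n := j + 3)
      ((Finset.card_insert_le _ _).trans (by omega)) (by simpa using hk)
    refine ⟨S', hc, fun v => ?_⟩
    obtain ⟨u, hu, huv⟩ : ∃ u ∈ S', AdjNat G u v ∨ (u : ℕ) = v := by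
      by_cases hv : AdjNat G x v ∨ x = v
      · exact ⟨⟨x, hx⟩, hS' (Finset.mem_insert_self _ _), hv⟩
      · obtain ⟨u, hu, huv⟩ := h v hv
        exact ⟨u, hS' (Finset.mem_insert_of_mem hu), huv⟩
    rw [adjNat_coe, Fin.val_inj] at huv
    rcases huv with huv | rfl
    · exact .inr ⟨u, hu, huv⟩
    · exact .inl hu

theorem sum_heavy_mul_le (k : ℕ) :
    (∑ x ∈ Finset.range n, bit (Heavy n k (AdjNat G) x)) * n ≤
      k * (2 * G.edgeSet.ncard + n) := by
  classical
  have hdeg : ∀ x : Fin n, (Finset.univ.filter fun v : Fin n => G.Adj x v ∨ x = v).card ≤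
      G.degree x + 1 := by
    intro x
    rw [Finset.filter_or]
    refine (Finset.card_union_le _ _).trans (Nat.add_le_add ?_ ?_)
    · rw [← SimpleGraph.card_neighborFinset_eq_degree, SimpleGraph.neighborFinset_eq_filter]
    · rw [Finset.filter_eq]; simp
  have hE : G.edgeSet.ncard = G.edgeFinset.card := by
    rw [Set.ncard_eq_toFinset_card', SimpleGraph.edgeFinset]
  calc (∑ x ∈ Finset.range n, bit (Heavy n k (AdjNat G) x)) * n
      = ∑ x : Fin n, bit (Heavy n k (AdjNat G) x) * n := by
        rw [Finset.sum_mul, Finset.sum_range]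
    _ ≤ ∑ x : Fin n, k * (G.degree x + 1) := by
        refine Finset.sum_le_sum fun x _ => ?_
        by_cases hx : Heavy n k (AdjNat G) x
        · rw [bit_true hx, one_mul]
          exact (heavy_iff.1 hx).trans (Nat.mul_le_mul_left k (hdeg x))
        · rw [bit_false hx]; omega
    _ = k * (2 * G.edgeSet.ncard + n) := by
        rw [← Finset.mul_sum, Finset.sum_add_distrib, SimpleGraph.sum_degrees_eq_twice_card_edges,
          hE]
        simp

end

/-! ## The running time -/

theorem searchTime_le {M n : ℕ} (hn : 1 ≤ n) (j : ℕ) :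
    searchTime M n j ≤ (27 + 24 * j) * (n ^ j * (M + n * n)) := by
  have hnn : n ≤ n * n := Nat.le_mul_of_pos_left n hn
  induction j with
  | zero => simp only [searchTime]; ring_nf; nlinarith
  | succ j ih =>
    have h1 : n * n ≤ n ^ (j + 1) * (M + n * n) :=
      (Nat.le_add_left _ M).trans (Nat.le_mul_of_pos_left _ (by positivity))
    have h2 := Nat.mul_le_mul_left n ih
    have h3 : n * ((27 + 24 * j) * (n ^ j * (M + n * n))) =
      (27 + 24 * j) * (n ^ (j + 1) * (M + n * n)) := by ring
    simp only [searchTime]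
    generalize n ^ (j + 1) * (M + n * n) = Y at *
    nlinarith

theorem domTime_le {M n k j : ℕ} {G : SimpleGraph (Fin n)} (hn : 1 ≤ n) :
    n * n * 14 + 8 + (∑ x ∈ Finset.range n,
        (11 * n + 13 + bit (Heavy n k (AdjNat G) x) * searchTime M n j + 4) + 3 + 5) ≤
      58 * (n * n) + (∑ x ∈ Finset.range n, bit (Heavy n k (AdjNat G) x)) *
        ((27 + 24 * j) * (n ^ j * (M + n * n))) := by
  have hnn : n ≤ n * n := Nat.le_mul_of_pos_left n hn
  have h : ∑ x ∈ Finset.range n,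
      (11 * n + 13 + bit (Heavy n k (AdjNat G) x) * searchTime M n j + 4) =
      n * (11 * n + 17) + (∑ x ∈ Finset.range n, bit (Heavy n k (AdjNat G) x)) *
        searchTime M n j := by
    simp only [Finset.sum_add_distrib, Finset.sum_mul, Finset.sum_const, Finset.card_range,
      smul_eq_mul]
    ring
  have h' := Nat.mul_le_mul_left (∑ x ∈ Finset.range n, bit (Heavy n k (AdjNat G) x))
    (searchTime_le (M := M) hn j)
  rw [h]
  nlinarith

theorem domTime_le_rpow {h n j k m M : ℕ} {α c c₀ τ : ℝ} (hn : 1 ≤ n) (hα : 1 ≤ α)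
    (hτ : 2 ≤ τ) (hh : h * n ≤ k * (2 * m + n)) (hm : (m : ℝ) ≤ c * (n : ℝ) ^ α)
    (hM : (M : ℝ) ≤ |c₀| * (n : ℝ) ^ τ) :
    ((58 * (n * n) + h * ((27 + 24 * j) * (n ^ j * (M + n * n))) : ℕ) : ℝ) ≤
      (58 + k * (2 * |c| + 1) * ((27 + 24 * j) * (|c₀| + 1))) *
        (n : ℝ) ^ ((j : ℝ) + (α - 1) + τ) := by
  have hX : (1 : ℝ) ≤ n := by exact_mod_cast hn
  have hX0 : (0 : ℝ) < n := by linarith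
  have hsq : (n : ℝ) * n ≤ (n : ℝ) ^ τ := by
    calc (n : ℝ) * n = (n : ℝ) ^ (2 : ℝ) := by rw [Real.rpow_two]; ring
      _ ≤ _ := Real.rpow_le_rpow_of_exponent_le hX hτ
  have hsq' : (n : ℝ) * n ≤ (n : ℝ) ^ ((j : ℝ) + (α - 1) + τ) :=
    hsq.trans (Real.rpow_le_rpow_of_exponent_le hX (by
      have : (0 : ℝ) ≤ j := by positivity
      linarith))
  have hh' : (h : ℝ) ≤ k * (2 * |c| + 1) * (n : ℝ) ^ (α - 1) := by
    have h1 : (h : ℝ) * n ≤ k * (2 * m + n) := by exact_mod_cast hh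
    have h2 : (n : ℝ) ≤ (n : ℝ) ^ α := by
      simpa using Real.rpow_le_rpow_of_exponent_le hX hα
    have h3 : (n : ℝ) ^ (α - 1) * n = (n : ℝ) ^ α := by
      rw [Real.rpow_sub_one hX0.ne']; field_simp
    have h4 : c * (n : ℝ) ^ α ≤ |c| * (n : ℝ) ^ α :=
      mul_le_mul_of_nonneg_right (le_abs_self c) (by positivity)
    refine le_of_mul_le_mul_right (h1.trans ?_) hX0
    rw [mul_assoc, h3, mul_assoc]
    exact mul_le_mul_of_nonneg_left (by linarith) (by positivity)
  have hMn : (M : ℝ) + n * n ≤ (|c₀| + 1) * (n : ℝ) ^ τ := by linarith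
  push_cast
  calc (58 * ((n : ℝ) * n) + h * ((27 + 24 * j) * ((n : ℝ) ^ j * (M + n * n))))
      ≤ 58 * (n : ℝ) ^ ((j : ℝ) + (α - 1) + τ) + (k * (2 * |c| + 1) * (n : ℝ) ^ (α - 1)) *
        ((27 + 24 * j) * ((n : ℝ) ^ j * ((|c₀| + 1) * (n : ℝ) ^ τ))) := by gcongr
    _ = _ := by
      rw [Real.rpow_add hX0, Real.rpow_add hX0, Real.rpow_natCast]
      ring

open Classical in
theorem exists_domProg_of_matMulInTime {τ : ℝ} (hτ : 2 ≤ τ) (hmul : MatMulInTime τ) (j : ℕ) :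
    ∃ (p : Prog) (d : ℕ), ∀ α : ℝ, 1 ≤ α → ∀ c : ℝ, ∃ C : ℝ, 0 ≤ C ∧
      ∀ n : ℕ, 1 ≤ n → ∀ G : SimpleGraph (Fin n),
        (G.edgeSet.ncard : ℝ) ≤ c * (n : ℝ) ^ α →
        DecidesDominatingSetWithin p d (j + 3) G (C * (n : ℝ) ^ ((j : ℝ) + (α - 1) + τ)) := by
  obtain ⟨p, d, c₀, hp⟩ := hmul 0
  obtain ⟨b, hb⟩ := p.exists_writes_lt
  refine ⟨domProg (b + 3) p (j + 3) j, d + (j + 4), fun α hα c =>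
    ⟨58 + (j + 3 : ℕ) * (2 * |c| + 1) * ((27 + 24 * j) * (|c₀| + 1)), by positivity,
      fun n hn G hG w hw s hs hm => ?_⟩⟩
  have hd : (n + 1) ^ d ≤ 2 ^ w :=
    (Nat.pow_le_pow_right (by omega) (by omega)).trans hw
  have h2 : (n + 1) ^ (j + 4) ≤ 2 ^ w :=
    (Nat.pow_le_pow_right (by omega) (by omega)).trans hw
  have hnn : n * n < 2 ^ w := by
    have : (n + 1) ^ 2 ≤ (n + 1) ^ (j + 4) := Nat.pow_le_pow_right (by omega) (by omega)
    nlinarith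
  have hkn : (j + 3) * n < 2 ^ w := by
    have h3 : j + 3 < 2 ^ (j + 3) := Nat.lt_two_pow_self
    have h4 : 2 ^ (j + 3) ≤ (n + 1) ^ (j + 3) := Nat.pow_le_pow_left (by omega) _
    have h5 : (n + 1) ^ (j + 4) = (n + 1) ^ (j + 3) * (n + 1) := pow_succ _ _
    have h6 : (j + 3) * (n + 1) ≤ (n + 1) ^ (j + 3) * (n + 1) :=
      Nat.mul_le_mul_right _ (by omega)
    nlinarith
  have hn_lt : n < 2 ^ w := (Nat.le_mul_of_pos_left n hn).trans_lt hnn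
  have hM : Multiplies p w n ⌊c₀ * (n : ℝ) ^ τ⌋₊ := by
    intro A B hA hB s h0 hsA hsB
    obtain ⟨t, s', hr, ht, hout⟩ :=
      hp n hn A B (by simpa using hA) (by simpa using hB) w hd s h0 hsA hsB
    exact ⟨t, s', hr, Nat.le_floor ht, hout⟩
  have hMle : ((⌊c₀ * (n : ℝ) ^ τ⌋₊ : ℕ) : ℝ) ≤ |c₀| * (n : ℝ) ^ τ := by
    refine (Nat.cast_le.2 (Nat.floor_le_floor (b := |c₀| * (n : ℝ) ^ τ) ?_)).trans
      (Nat.floor_le (by positivity))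
    exact mul_le_mul_of_nonneg_right (le_abs_self _) (by positivity)
  have hreg : s.reg 0 = BitVec.ofNat w n := by
    rw [← hs, BitVec.ofNat_toNat, BitVec.setWidth_eq]
  have hmem : ∀ a < n * n, s.mem 0 (BitVec.ofNat w a) =
      BitVec.ofNat w (bit (AdjNat G (a / n) (a % n))) := by
    intro a ha
    have := hm ⟨a / n, Nat.div_lt_of_lt_mul ha⟩ ⟨a % n, Nat.mod_lt _ hn⟩
    rw [SimpleGraph.adjMatrix_apply, ← adjNat_coe] at this
    simp only [Nat.div_add_mod'] at this
    rw [bit, ← this, BitVec.ofNat_toNat, BitVec.setWidth_eq]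
  obtain ⟨t, s', hr, ht, hout⟩ := halts_domProg (b := b + 3) (k := j + 3) (j := j)
    (fun x => ⟨fun h => by have := (hb x).1 h; omega, fun h => by have := (hb x).2 h; omega⟩)
    hM adjNat_comm hn hnn hkn (by omega) hreg hmem
  refine ⟨t, s', hr, ?_, ?_⟩
  · refine (Nat.cast_le.2 (ht.trans (domTime_le hn))).trans ?_
    exact domTime_le_rpow hn hα hτ (sum_heavy_mul_le (j + 3)) hG hMle
  · rw [hout, ← hasDominatingSet_iff hn]
    refine Iff.trans ?_ bit_ne_zero
    exact not_congr (ofNat_inj (b := 0) ((bit_le_one _).trans_lt (by omega)) (Nat.two_pow_pos w))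

end WordRAM

theorem mainTheorem2 (k : ℕ) (hk : 3 ≤ k) :
    (WordRAM.MatMulInTime 2 →
      ∃ (p : WordRAM.Prog) (d : ℕ), ∀ α : ℝ, 1 ≤ α → α ≤ 2 → ∀ c : ℝ, ∃ C : ℝ,
        ∀ n : ℕ, 1 ≤ n → ∀ G : SimpleGraph (Fin n),
          (G.edgeSet.ncard : ℝ) ≤ c * (n : ℝ) ^ α →
          WordRAM.DecidesDominatingSetWithin p d k G (C * (n : ℝ) ^ ((k : ℝ) - 2 + α))) ∧
    (WordRAM.matMulExponent = 2 →
      ∀ ε : ℝ, 0 < ε →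
      ∃ (p : WordRAM.Prog) (d : ℕ), ∀ α : ℝ, 1 ≤ α → α ≤ 2 → ∀ c : ℝ, ∃ C : ℝ,
        ∀ n : ℕ, 1 ≤ n → ∀ G : SimpleGraph (Fin n),
          (G.edgeSet.ncard : ℝ) ≤ c * (n : ℝ) ^ α →
          WordRAM.DecidesDominatingSetWithin p d k G (C * (n : ℝ) ^ ((k : ℝ) - 2 + α + ε))) := by
  obtain ⟨j, rfl⟩ : ∃ j, k = j + 3 := ⟨k - 3, by omega⟩
  have key : ∀ τ ε : ℝ, 2 ≤ τ → τ ≤ 2 + ε → WordRAM.MatMulInTime τ →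
      ∃ (p : WordRAM.Prog) (d : ℕ), ∀ α : ℝ, 1 ≤ α → α ≤ 2 → ∀ c : ℝ, ∃ C : ℝ,
        ∀ n : ℕ, 1 ≤ n → ∀ G : SimpleGraph (Fin n),
          (G.edgeSet.ncard : ℝ) ≤ c * (n : ℝ) ^ α →
          WordRAM.DecidesDominatingSetWithin p d (j + 3) G
            (C * (n : ℝ) ^ (((j + 3 : ℕ) : ℝ) - 2 + α + ε)) := by
    intro τ ε hτ hτε hmul
    obtain ⟨p, d, h⟩ := WordRAM.exists_domProg_of_matMulInTime hτ hmul j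
    refine ⟨p, d, fun α hα _ c => ?_⟩
    obtain ⟨C, hC, h⟩ := h α hα c
    refine ⟨C, fun n hn G hG w hw s hs hm => ?_⟩
    obtain ⟨t, s', hr, ht, hout⟩ := h n hn G hG w hw s hs hm
    refine ⟨t, s', hr, ht.trans (mul_le_mul_of_nonneg_left ?_ hC), hout⟩
    refine Real.rpow_le_rpow_of_exponent_le (by exact_mod_cast hn) ?_
    push_cast
    linarith
  refine ⟨fun h => ?_, fun h ε hε => ?_⟩
  · simpa only [add_zero] using key 2 0 le_rfl (by simp) h
  · rw [WordRAM.matMulExponent] at h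
    have hne : {τ : ℝ | WordRAM.MatMulInTime τ}.Nonempty := by
      by_contra hne
      rw [Set.not_nonempty_iff_eq_empty.1 hne, Real.sInf_empty] at h
      norm_num at h
    have hbdd : BddBelow {τ : ℝ | WordRAM.MatMulInTime τ} := by
      by_contra hbdd
      rw [Real.sInf_of_not_bddBelow hbdd] at h
      norm_num at h
    obtain ⟨τ, hτ, hlt⟩ := exists_lt_of_csInf_lt hne (b := 2 + ε) (by rw [h]; linarith)
    exact key τ ε (h ▸ csInf_le hbdd hτ) hlt.le hτ
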